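/- Let $d\ge 1$ and let $M$ be an integer $d\times d$ matrix all of whose eigenvalues are greater than $1$ in absolute value; put $m=|\det M|$ and let $M^*$ be the transpose of $M$. Let $D=\{s_0,\dots,s_{m-1}\}\subset\mathbb Z^d$ be a set of digits for $M$, i.e. $s_0=\mathbf 0$ and $s_i-s_j\notin M\mathbb Z^d$ for $i\ne j$, and let $D^*=\{s_0^*,\dots,s_{m-1}^*\}$ be a set of digits for $M^*$. Let $V$ be the generalized Vilenkin group of $(M,D)$: the sequences $x=(x_j)_{j\in\mathbb Z}$ with $x_j\in D$ and only finitely many nonzero $x_j$ with $j<0$, with coordinatewise addition modulo $M$ (denoted $\oplus$), the topology in which the sets $U_l=\{x: x_j=\mathbf 0\ \forall j\le l\}$, $l\in\mathbb Z$, form a neighbourhood basis of the neutral element, and the Haar measure $\mu$ with $\mu(U_0)=1$; let $V^*$ be the generalized Vilenkin group of $(M^*,D^*)$. Define $\mathcal M$ on $V$ by $(\mathcal Mx)_j=x_{j+1}$ and $\mathcal M^*$ on $V^*$ likewise; $H=\{x\in V: x_j=\mathbf 0\ \forall j>0\}$; for $k\in\mathbb Z_+$ with $m$-ary expansion $k=\sum_{j\ge0}k_jm^j$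 let $\gamma_{[k]}\in H$ be given by $(\gamma_{[k]})_{-j}=s_{k_j}$, $j\ge 0$; and set $$\chi(x,\omega)=\exp\Big(2\pi i\sum_{j\in\mathbb Z}\langle M^{-1}x_j,\omega_{1-j}\rangle\Big),\qquad \widehat\varphi(\omega)=\int_V\varphi(x)\overline{\chi(x,\omega)}\,d\mu(x),\qquad x\in V,\ \omega\in V^*.$$ A Walsh polynomial is a finite linear combination of the functions $W_k=\chi(\gamma_{[k]},\cdot)$ on $V^*$. A function $\varphi\in L_2(V)$ is refinable if there are numbers $\alpha_k$ with $\varphi(x)=\sum_{k=0}^\infty\alpha_k\varphi(\mathcal Mx\oplus\gamma_{[k]})$ for almost all $x\in V$; it is orthogonal if the system $\{\varphi(\cdot\oplus h): h\in H\}$ is orthonormal in $L_2(V)$. A mask of a compactly supported $\varphi\in L_2(V)$ is a Walsh polynomial $m_0$ with $\widehat\varphi(\omega)=m_0({\mathcal M^*}^{-1}\omega)\,\widehat\varphi({\mathcal M^*}^{-1}\omega)$ for all $\omega\in V^*$. Theorem. If a refinable function $\varphi\in L_2(V)$ with compact support is orthogonal, then it has exactly one mask $m_0$, and $$\sum_{k=0}^{m-1}\big|m_0\big({\mathcal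 M^*}^{-1}(\omega\oplus s_k^*)\big)\big|^2=1\qquad\text{for all }\omega\in V^*,$$ where $s_k^*$ is regarded as the element of $V^*$ whose $0$-th coordinate is $s_k^*$ and whose other coordinates are $\mathbf 0$. -/

import Mathlib

namespace Vilenkin

open MeasureTheory Filter Topology Matrix

noncomputable section

/-- An integer `d × d` matrix all of whose (complex) eigenvalues have absolute value `> 1`. -/
structure DilationMatrix (d : ℕ) where
  mat : Matrix (Fin d) (Fin d) ℤ
  expanding : ∀ z : ℂ,
    Module.End.HasEigenvalue (Matrix.toLin' (mat.map (Int.cast : ℤ → ℂ))) z → 1 < ‖z‖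

variable {d : ℕ}

namespace DilationMatrix

/-- The number `m = |det M|`. -/
def m (M : DilationMatrix d) : ℕ := M.mat.det.natAbs

theorem det_ne_zero (M : DilationMatrix d) : M.mat.det ≠ 0 := by
  intro h
  have h1 : (M.mat.map (Int.cast : ℤ → ℂ)).det = 0 := by
    have := (Int.castRingHom ℂ).map_det M.mat
    rw [h] at this
    simpa using this.symm
  obtain ⟨v, hv, hv0⟩ := Matrix.exists_mulVec_eq_zero_iff.mpr h1
  have h2 : Module.End.HasEigenvalue (Matrix.toLin' (M.mat.map (Int.cast : ℤ → ℂ))) 0 := by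
    apply Module.End.hasEigenvalue_of_hasEigenvector (x := v)
    refine ⟨?_, hv⟩
    rw [Module.End.mem_eigenspace_iff]
    simpa using hv0
  have := M.expanding 0 h2
  norm_num at this

theorem m_pos (M : DilationMatrix d) : 0 < M.m := Int.natAbs_pos.mpr M.det_ne_zero

/-- The transposed matrix `M*`. -/
def transpose (M : DilationMatrix d) : DilationMatrix d where
  mat := M.matᵀ
  expanding := by
    intro z hz
    apply M.expanding z
    rw [Module.End.hasEigenvalue_iff_isRoot_charpoly, Matrix.charpoly_toLin'] at hz ⊢
    rwa [← Matrix.charpoly_transpose, ← Matrix.transpose_map]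

/-- Congruence modulo `M`: `l ≡ k (mod M)` if `l - k = M s` for some integer vector `s`. -/
def Congruent (M : DilationMatrix d) (l k : Fin d → ℤ) : Prop :=
  ∃ s : Fin d → ℤ, l - k = M.mat *ᵥ s

/-- The sublattice `M ℤ^d` of `ℤ^d`. -/
def lattice (M : DilationMatrix d) : Submodule ℤ (Fin d → ℤ) := LinearMap.range M.mat.mulVecLin

theorem mk_eq_iff (M : DilationMatrix d) (l k : Fin d → ℤ) :
    (Submodule.Quotient.mk l : (Fin d → ℤ) ⧸ M.lattice) = Submodule.Quotient.mk k ↔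
      M.Congruent l k := by
  rw [Submodule.Quotient.eq]
  constructor
  · rintro ⟨s, hs⟩
    exact ⟨s, hs.symm⟩
  · rintro ⟨s, hs⟩
    exact ⟨s, hs.symm⟩

theorem card_quotient (M : DilationMatrix d) : Nat.card ((Fin d → ℤ) ⧸ M.lattice) = M.m := by
  have hinj : Function.Injective M.mat.mulVecLin := by
    rw [← LinearMap.ker_eq_bot, LinearMap.ker_eq_bot']
    intro v hv
    exact Matrix.eq_zero_of_mulVec_eq_zero M.det_ne_zero hv
  have h := Submodule.natAbs_det_equiv M.lattice (LinearEquiv.ofInjective M.mat.mulVecLin hinj)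
  rw [← h, m, ← LinearMap.det_toLin']
  rfl

end DilationMatrix

/-- A set of digits `s_0 = 0, s_1, …, s_{m-1}` for `M`: pairwise incongruent modulo `M`. -/
structure DigitSet (M : DilationMatrix d) where
  s : Fin M.m → (Fin d → ℤ)
  s_zero : s ⟨0, M.m_pos⟩ = 0
  incongruent : ∀ i j, i ≠ j → ¬ M.Congruent (s i) (s j)

namespace DigitSet

variable {M : DilationMatrix d}

/-- The set `{s_0, …, s_{m-1}}` as a type. -/
def Digit (D : DigitSet M) : Type := {v : Fin d → ℤ // ∃ i, D.s i = v}

/-- The digit `s_i`. -/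
def digit (D : DigitSet M) (i : Fin M.m) : D.Digit := ⟨D.s i, i, rfl⟩

theorem digit_bijective (D : DigitSet M) : Function.Bijective D.digit := by
  constructor
  · intro i j h
    by_contra hij
    have h' : D.s i = D.s j := congrArg Subtype.val h
    exact D.incongruent i j hij ⟨0, by simp [h']⟩
  · rintro ⟨v, i, rfl⟩
    exact ⟨i, rfl⟩

instance (D : DigitSet M) : Finite D.Digit := Finite.of_surjective _ D.digit_bijective.2

/-- The residue class of a digit modulo `M`. -/
def toQuotient (D : DigitSet M) (a : D.Digit) : (Fin d → ℤ) ⧸ M.lattice :=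
  Submodule.Quotient.mk a.1

theorem toQuotient_bijective (D : DigitSet M) : Function.Bijective D.toQuotient := by
  have hcard : Nat.card D.Digit = Nat.card ((Fin d → ℤ) ⧸ M.lattice) := by
    rw [M.card_quotient, ← Nat.card_eq_of_bijective _ D.digit_bijective, Nat.card_fin]
  have hfin : Finite ((Fin d → ℤ) ⧸ M.lattice) :=
    Nat.finite_of_card_ne_zero (by rw [M.card_quotient]; exact M.m_pos.ne')
  refine (Nat.bijective_iff_injective_and_card _).mpr ⟨?_, hcard⟩
  rintro ⟨a, i, rfl⟩ ⟨b, j, rfl⟩ h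
  have h' := (M.mk_eq_iff _ _).mp h
  by_cases hij : i = j
  · subst hij
    rfl
  · exact absurd h' (D.incongruent i j hij)

/-- Addition of digits modulo `M`: the digits represent the residue classes modulo `M`, and the
group structure of `ℤ^d / M ℤ^d` is carried over to them (see `add_congruent` and `zero_val`). -/
instance (D : DigitSet M) : AddCommGroup D.Digit :=
  (Equiv.ofBijective _ D.toQuotient_bijective).addCommGroup

theorem toQuotient_add (D : DigitSet M) (a b : D.Digit) :
    D.toQuotient (a + b) = D.toQuotient a + D.toQuotient b :=
  (Equiv.ofBijective _ D.toQuotient_bijective).apply_symm_apply _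

theorem toQuotient_zero (D : DigitSet M) : D.toQuotient 0 = 0 :=
  (Equiv.ofBijective _ D.toQuotient_bijective).apply_symm_apply _

theorem add_congruent (D : DigitSet M) (a b : D.Digit) :
    M.Congruent (a + b : D.Digit).1 (a.1 + b.1) :=
  (M.mk_eq_iff _ _).mp (D.toQuotient_add a b)

theorem digit_zero (D : DigitSet M) : D.digit ⟨0, M.m_pos⟩ = 0 := by
  apply D.toQuotient_bijective.1
  rw [D.toQuotient_zero]
  simp [toQuotient, digit, D.s_zero]

theorem zero_val (D : DigitSet M) : (0 : D.Digit).1 = 0 := by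
  rw [← D.digit_zero]
  exact D.s_zero

/-- The two-sided digit sequences that vanish at all sufficiently negative indices. -/
def seqs (D : DigitSet M) : AddSubgroup (ℤ → D.Digit) where
  carrier := {x | ∃ N : ℤ, ∀ j < N, x j = 0}
  zero_mem' := ⟨0, fun _ _ => rfl⟩
  add_mem' := by
    rintro x y ⟨N, hN⟩ ⟨K, hK⟩
    refine ⟨min N K, fun j hj => ?_⟩
    rw [Pi.add_apply, hN j (lt_of_lt_of_le hj (min_le_left _ _)),
      hK j (lt_of_lt_of_le hj (min_le_right _ _)), add_zero]
  neg_mem' := by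
    rintro x ⟨N, hN⟩
    exact ⟨N, fun j hj => by rw [Pi.neg_apply, hN j hj, neg_zero]⟩

end DigitSet

variable {M : DilationMatrix d}

/-- The generalized Vilenkin group associated with `M` and the set of digits `D`: digit sequences
with finitely many nonzero entries at negative indices, added coordinatewise modulo `M`. -/
def V (D : DigitSet M) : Type := D.seqs

namespace V

instance (D : DigitSet M) : AddCommGroup (V D) := inferInstanceAs (AddCommGroup D.seqs)

variable {D : DigitSet M}

/-- The coordinate `x_j`. -/
def coord (x : V D) (j : ℤ) : D.Digit := x.1 j

theorem coord_add (x y : V D) (j : ℤ) : (x + y).coord j = x.coord j + y.coord j := rfl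

theorem coord_neg (x : V D) (j : ℤ) : (-x).coord j = -x.coord j := rfl

theorem coord_zero (j : ℤ) : (0 : V D).coord j = 0 := rfl

theorem ext_coord {x y : V D} (h : ∀ j, x.coord j = y.coord j) : x = y :=
  Subtype.ext (funext h)

variable (D) in
/-- `U_l = {x : x_j = 0 for all j ≤ l}`. -/
def U (l : ℤ) : AddSubgroup (V D) where
  carrier := {x | ∀ j ≤ l, x.coord j = 0}
  zero_mem' := fun _ _ => rfl
  add_mem' := fun {x y} hx hy j hj => by rw [coord_add, hx j hj, hy j hj, add_zero]
  neg_mem' := fun {x} hx j hj => by rw [coord_neg, hx j hj, neg_zero]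

theorem U_anti {k l : ℤ} (h : k ≤ l) : U D l ≤ U D k :=
  fun _ hx j hj => hx j (hj.trans h)

/-- The topology in which the sets `U_l`, `l ∈ ℤ`, form a neighbourhood basis at the neutral
element (and their translates a neighbourhood basis at every point). -/
instance : TopologicalSpace (V D) where
  IsOpen S := ∀ x ∈ S, ∃ l : ℤ, ∀ u ∈ U D l, x + u ∈ S
  isOpen_univ := fun _ _ => ⟨0, fun _ _ => trivial⟩
  isOpen_inter := by
    intro S T hS hT x hx
    obtain ⟨k, hk⟩ := hS x hx.1
    obtain ⟨l, hl⟩ := hT x hx.2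
    exact ⟨max k l, fun u hu => ⟨hk u (U_anti (le_max_left _ _) hu),
      hl u (U_anti (le_max_right _ _) hu)⟩⟩
  isOpen_sUnion := by
    rintro F hF x ⟨S, hS, hx⟩
    obtain ⟨l, hl⟩ := hF S hS x hx
    exact ⟨l, fun u hu => ⟨S, hS, hl u hu⟩⟩

theorem isOpen_iff {S : Set (V D)} :
    IsOpen S ↔ ∀ x ∈ S, ∃ l : ℤ, ∀ u ∈ U D l, x + u ∈ S := Iff.rfl

theorem isOpen_coset (x : V D) (l : ℤ) : IsOpen {y : V D | y - x ∈ U D l} := by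
  rw [isOpen_iff]
  intro y hy
  refine ⟨l, fun u hu => ?_⟩
  have : y + u - x = (y - x) + u := by abel
  rw [Set.mem_ofPred_eq, this]
  exact add_mem hy hu

instance : IsTopologicalAddGroup (V D) where
  continuous_add := by
    rw [continuous_def]
    intro S hS
    rw [isOpen_prod_iff]
    intro a b hab
    obtain ⟨l, hl⟩ := isOpen_iff.mp hS _ hab
    refine ⟨_, _, isOpen_coset a l, isOpen_coset b l, by simp [zero_mem], by simp [zero_mem], ?_⟩
    rintro ⟨p, q⟩ ⟨hp, hq⟩
    have : p + q = a + b + ((p - a) + (q - b)) := by abel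
    rw [Set.mem_preimage, this]
    exact hl _ (add_mem hp hq)
  continuous_neg := by
    rw [continuous_def]
    intro S hS
    rw [isOpen_iff]
    intro x hx
    obtain ⟨l, hl⟩ := isOpen_iff.mp hS _ hx
    refine ⟨l, fun u hu => ?_⟩
    rw [Set.mem_preimage, neg_add]
    exact hl _ (neg_mem hu)

instance : MeasurableSpace (V D) := borel (V D)

instance : BorelSpace (V D) := ⟨rfl⟩

/-- The element of `U_0` with prescribed coordinates at `1, 2, 3, …`. -/
def ofFrac (a : ℕ → D.Digit) : V D :=
  ⟨fun j => if 1 ≤ j then a (j - 1).toNat else 0,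
    1, fun j hj => by simp [not_le.mpr hj]⟩

theorem range_ofFrac : Set.range (ofFrac : (ℕ → D.Digit) → V D) = (U D 0 : Set (V D)) := by
  ext x
  constructor
  · rintro ⟨a, rfl⟩ j hj
    exact if_neg (by omega)
  · intro hx
    refine ⟨fun n => x.coord (n + 1), ext_coord fun j => ?_⟩
    by_cases hj : 1 ≤ j
    · refine (if_pos hj).trans ?_
      have : (((j - 1).toNat : ℕ) : ℤ) + 1 = j := by omega
      exact congrArg x.coord this
    · exact (if_neg hj).trans (hx j (by omega)).symm

theorem isCompact_U : IsCompact (U D 0 : Set (V D)) := by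
  let _ : TopologicalSpace D.Digit := ⊥
  have : DiscreteTopology D.Digit := ⟨rfl⟩
  rw [← range_ofFrac]
  apply isCompact_range
  rw [continuous_def]
  intro S hS
  rw [isOpen_pi_iff]
  intro a ha
  obtain ⟨l, hl⟩ := isOpen_iff.mp hS _ ha
  refine ⟨Finset.range l.toNat, fun n => {a n}, fun n _ => ⟨isOpen_discrete _, rfl⟩, ?_⟩
  intro b hb
  have : ofFrac b = ofFrac a + (ofFrac b - ofFrac a) := by abel
  rw [Set.mem_preimage, this]
  apply hl
  intro j hj
  rw [sub_eq_add_neg, coord_add, coord_neg, ← sub_eq_add_neg, sub_eq_zero]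
  by_cases hj1 : 1 ≤ j
  · have hmem : (j - 1).toNat ∈ Finset.range l.toNat := by
      rw [Finset.mem_range]
      omega
    have : b (j - 1).toNat = a (j - 1).toNat := hb _ hmem
    simpa [coord, ofFrac, hj1] using this
  · simp [coord, ofFrac, hj1]

theorem isOpen_U (l : ℤ) : IsOpen (U D l : Set (V D)) := by
  rw [isOpen_iff]
  exact fun x hx => ⟨l, fun u hu => add_mem hx hu⟩

variable (D) in
/-- `U = U_0` as a compact set with nonempty interior. -/
def compactU : TopologicalSpace.PositiveCompacts (V D) where
  carrier := U D 0
  isCompact' := isCompact_U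
  interior_nonempty' := by
    rw [(isOpen_U 0).interior_eq]
    exact ⟨0, zero_mem _⟩

variable (D) in
/-- The Haar measure on `V`, normalized by `μ U = 1`. -/
def haar : Measure (V D) := Measure.addHaarMeasure (compactU D)

theorem haar_U : haar D (U D 0 : Set (V D)) = 1 := Measure.addHaarMeasure_self

/-- The dilation `(𝓜 x)_j = x_{j+1}`. -/
def dil : V D ≃ V D where
  toFun x := ⟨fun j => x.coord (j + 1), by
    obtain ⟨N, hN⟩ := x.2
    exact ⟨N - 1, fun j hj => hN _ (by omega)⟩⟩
  invFun x := ⟨fun j => x.coord (j - 1), by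
    obtain ⟨N, hN⟩ := x.2
    exact ⟨N + 1, fun j hj => hN _ (by omega)⟩⟩
  left_inv x := ext_coord fun j => congrArg x.coord (by ring)
  right_inv x := ext_coord fun j => congrArg x.coord (by ring)

variable (D) in
/-- `H = {x : x_j = 0 for all j > 0}`. -/
def H : Set (V D) := {x | ∀ j > 0, x.coord j = 0}

variable (D) in
/-- The digit `s_i` regarded as the element of `H ⊆ V` with `0`-th coordinate `s_i` and all other
coordinates zero. -/
def ofDigit (i : Fin M.m) : V D :=
  ⟨fun j => if j = 0 then D.digit i else 0, 0, fun _ hj => if_neg hj.ne⟩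

variable (D) in
/-- The element `γ_[k]` of `H` with `(γ_[k])_{-j} = s_{k_j}`, where `k = ∑ k_j m^j` is the
`m`-ary expansion of `k`, that is, `k_j = ⌊k / m^j⌋ mod m`. -/
def gam (k : ℕ) : V D :=
  ⟨fun i => if i ≤ 0 then D.digit ⟨k / M.m ^ (-i).toNat % M.m, Nat.mod_lt _ M.m_pos⟩ else 0, by
    refine ⟨-(k : ℤ), fun i hi => ?_⟩
    beta_reduce
    rw [if_pos (by omega), ← D.digit_zero]
    congr 2
    rcases (Nat.succ_le_of_lt M.m_pos).eq_or_lt with h1 | h2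
    · rw [← h1]
      exact Nat.mod_one _
    · rw [Nat.div_eq_of_lt, Nat.zero_mod]
      calc k < M.m ^ k := Nat.lt_pow_self h2
        _ ≤ M.m ^ (-i).toNat := Nat.pow_le_pow_right M.m_pos (by omega)⟩

end V

open V

variable {D : DigitSet M} {E : DigitSet M.transpose}

/-- The pairing `χ(x, ω) = exp(2πi ∑_j ⟨M⁻¹ x_j, ω_{1-j}⟩)` of `V` and `V*`; only finitely many
terms of the sum are nonzero. -/
def chi (x : V D) (ω : V E) : ℂ :=
  Complex.exp (2 * Real.pi * Complex.I *
    ((∑ᶠ j : ℤ, ((M.mat.map (Int.cast : ℤ → ℝ))⁻¹ *ᵥ (fun i => ((x.coord j).1 i : ℝ))) ⬝ᵥ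
      (fun i => ((ω.coord (1 - j)).1 i : ℝ)) : ℝ) : ℂ))

/-- The Fourier transform of an integrable function on `V`, as a function on `V*`. (A compactly
supported function in `L₂(V)` is integrable.) -/
def fourier (E : DigitSet M.transpose) (φ : V D → ℂ) (ω : V E) : ℂ :=
  ∫ x, φ x * (starRingEnd ℂ) (chi x ω) ∂haar D

/-- The Walsh function `W_k = χ(γ_[k], ·)` on `V*`. -/
def walsh (D : DigitSet M) (E : DigitSet M.transpose) (k : ℕ) (ω : V E) : ℂ := chi (gam D k) ω

/-- A Walsh polynomial: a linear combination of `W_0, …, W_{m^n - 1}` for some `n`. -/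
def IsWalshPolynomial (D : DigitSet M) (E : DigitSet M.transpose) (p : V E → ℂ) : Prop :=
  ∃ (n : ℕ) (c : ℕ → ℂ), ∀ ω, p ω = ∑ k ∈ Finset.range (M.m ^ n), c k * walsh D E k ω

/-- `φ ∈ L₂(V)` is refinable: `φ(x) = ∑_{k=0}^∞ α_k φ(𝓜x ⊕ γ_[k])` for some numbers `α_k`, as an
equality of elements of `L₂(V)`, i.e. for almost all `x`. -/
def IsRefinable (φ : V D → ℂ) : Prop :=
  MemLp φ 2 (haar D) ∧ ∃ α : ℕ → ℂ, ∀ᵐ x ∂haar D,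
    Tendsto (fun n => ∑ k ∈ Finset.range n, α k * φ (dil x + gam D k)) atTop (𝓝 (φ x))

/-- The system `{φ(· ⊕ h) : h ∈ H}` is orthonormal in `L₂(V)`. -/
def IsOrthogonal (φ : V D → ℂ) : Prop :=
  ∀ h ∈ H D, ∀ h' ∈ H D,
    (h = h' → ∫ x, φ (x + h) * (starRingEnd ℂ) (φ (x + h')) ∂haar D = 1) ∧
    (h ≠ h' → ∫ x, φ (x + h) * (starRingEnd ℂ) (φ (x + h')) ∂haar D = 0)

/-- `m₀` is a mask of `φ`: a Walsh polynomial with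
`φ̂(ω) = m₀(𝓜*⁻¹ω) φ̂(𝓜*⁻¹ω)` on `V*`. -/
def IsMask (φ : V D → ℂ) (m₀ : V E → ℂ) : Prop :=
  IsWalshPolynomial D E m₀ ∧
    ∀ ω : V E, fourier E φ ω = m₀ (dil.symm ω) * fourier E φ (dil.symm ω)

end

end Vilenkin

namespace Vilenkin

open MeasureTheory Filter Topology Matrix V

noncomputable section

variable {d : ℕ} {M : DilationMatrix d} {D : DigitSet M} {E : DigitSet M.transpose}

/-! ### The determinant of a dilation matrix -/

namespace DilationMatrix

/-! Compact support makes the refinement equation finite (`IsRefinable.exists_finite_sum`). Its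
Fourier transform is the mask equation with m₀ = m⁻¹ ∑ α_k W_k (`coeffMask`), since translations
become characters and the dilation rescales Haar measure by m.

Substituting the refinement equation into the inner product of φ and φ(· ⊕ h), h ∈ H, gives m⁻¹ ∑
α_k conj(α_l) = δ_{h,0}, summed over the pairs with γ_k = 𝓜h ⊕ γ_l (`IsOrthogonal.sum_coeff`).
Expanding ∑ |m₀|² over the shifts s_i* gives a double sum over (k, l). Orthogonality of the digit
characters keeps only the pairs for which γ_k - γ_l has 0-th coordinate zero, that is, γ_k - γ_l =
𝓜h with h ∈ H. Grouped by h, the sum is ∑_h δ_{h,0} χ(h, ω) = 1 (`sum_norm_sq_coeffMask`).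

For uniqueness, the difference ∑ c_k W_k of two masks annihilates φ̂, so ∑ c_k φ(· ⊕ γ_k) has zero
Fourier transform. By injectivity (`ae_eq_zero_of_fourier_eq_zero`) it vanishes almost everywhere,
and orthonormality forces c_k = 0. -/

theorem transpose_m (M : DilationMatrix d) : M.transpose.m = M.m := by
  simp [m, transpose, Matrix.det_transpose]

/-- The determinant is the product of the complex eigenvalues, and there is at least one since d >
0. For m = 1 every γ_[k] would be 0, and the refinement series could not be truncated. -/
theorem one_lt_m (hd : 0 < d) (M : DilationMatrix d) : 1 < M.m := by
  set A : Matrix (Fin d) (Fin d) ℂ := M.mat.map (Int.cast : ℤ → ℂ) with hA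
  have hdet : A.det = (M.mat.det : ℂ) := ((Int.castRingHom ℂ).map_det M.mat).symm
  have hprod : A.det = A.charpoly.roots.prod :=
    Matrix.det_eq_prod_roots_charpoly_of_splits (IsAlgClosed.splits _)
  have hroots : ∀ z ∈ A.charpoly.roots, 1 < ‖z‖ := by
    intro z hz
    apply M.expanding z
    rw [Module.End.hasEigenvalue_iff_isRoot_charpoly, Matrix.charpoly_toLin']
    exact (Polynomial.mem_roots'.mp hz).2
  have hcard : A.charpoly.roots ≠ 0 := by
    intro h
    have h1 := IsAlgClosed.card_roots_eq_natDegree (p := A.charpoly)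
    rw [h, Matrix.charpoly_natDegree_eq_dim] at h1
    simp at h1
    omega
  have key : ∀ s : Multiset ℂ, (∀ z ∈ s, 1 < ‖z‖) → s ≠ 0 → 1 < ‖s.prod‖ := by
    intro s
    induction s using Multiset.induction_on with
    | empty => simp
    | cons a s ih =>
      intro h _
      rw [Multiset.prod_cons, norm_mul]
      have ha := h a (Multiset.mem_cons_self a s)
      by_cases hs : s = 0
      · simpa [hs] using ha
      · exact one_lt_mul_of_lt_of_le ha
          (ih (fun z hz => h z (Multiset.mem_cons_of_mem hz)) hs).le
  have h1 := key _ hroots hcard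
  rw [← hprod, hdet, Complex.norm_intCast] at h1
  have h2 : (1 : ℤ) < |M.mat.det| := by exact_mod_cast h1
  rw [Int.abs_eq_natAbs] at h2
  exact_mod_cast h2

end DilationMatrix

/-! ### Characters of the finite group of digits -/

/-- The real number `⟨M⁻¹ a, b⟩`. -/
def pairing (M : DilationMatrix d) (a b : Fin d → ℤ) : ℝ :=
  ((M.mat.map (Int.cast : ℤ → ℝ))⁻¹ *ᵥ (fun i => (a i : ℝ))) ⬝ᵥ (fun i => (b i : ℝ))

theorem isUnit_det_cast (M : DilationMatrix d) :
    IsUnit (M.mat.map (Int.cast : ℤ → ℝ)).det := by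
  have h : (M.mat.map (Int.cast : ℤ → ℝ)).det = (M.mat.det : ℝ) :=
    ((Int.castRingHom ℝ).map_det M.mat).symm
  rw [h, isUnit_iff_ne_zero]
  exact_mod_cast M.det_ne_zero

theorem pairing_add_left (a a' b : Fin d → ℤ) :
    pairing M (a + a') b = pairing M a b + pairing M a' b := by
  have : (fun i => (((a + a') i : ℤ) : ℝ)) = (fun i => (a i : ℝ)) + fun i => (a' i : ℝ) := by
    ext i; simp
  rw [pairing, this, Matrix.mulVec_add, add_dotProduct]
  rfl

theorem pairing_add_right (a b b' : Fin d → ℤ) :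
    pairing M a (b + b') = pairing M a b + pairing M a b' := by
  have : (fun i => (((b + b') i : ℤ) : ℝ)) = (fun i => (b i : ℝ)) + fun i => (b' i : ℝ) := by
    ext i; simp
  rw [pairing, this, dotProduct_add]
  rfl

theorem cast_mulVec (A : Matrix (Fin d) (Fin d) ℤ) (s : Fin d → ℤ) :
    (fun i => ((A *ᵥ s) i : ℝ)) = A.map (Int.cast : ℤ → ℝ) *ᵥ fun i => (s i : ℝ) := by
  ext i
  simp [Matrix.mulVec, dotProduct]

theorem pairing_lattice_left (s b : Fin d → ℤ) :
    pairing M (M.mat *ᵥ s) b = ((s ⬝ᵥ b : ℤ) : ℝ) := by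
  rw [pairing, cast_mulVec, Matrix.mulVec_mulVec, Matrix.nonsing_inv_mul _ (isUnit_det_cast M),
    Matrix.one_mulVec]
  simp [dotProduct]

/-- ⟨M⁻¹a, Mᵀt⟩ = ⟨a, t⟩ is an integer. This is why the dual group is built from the transpose: the
exponential depends on b only modulo Mᵀ. -/
theorem pairing_lattice_right (a t : Fin d → ℤ) :
    pairing M a (M.transpose.mat *ᵥ t) = ((a ⬝ᵥ t : ℤ) : ℝ) := by
  have : M.transpose.mat.map (Int.cast : ℤ → ℝ) = (M.mat.map (Int.cast : ℤ → ℝ))ᵀ := rfl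
  rw [pairing, cast_mulVec, this, Matrix.mulVec_transpose, dotProduct_comm,
    ← Matrix.dotProduct_mulVec, Matrix.mulVec_mulVec,
    Matrix.mul_nonsing_inv _ (isUnit_det_cast M), Matrix.one_mulVec, dotProduct_comm]
  simp [dotProduct]

/-- The complex number `exp(2πi⟨M⁻¹ a, b⟩)`. -/
def digitChar (M : DilationMatrix d) (a b : Fin d → ℤ) : ℂ :=
  Complex.exp (2 * Real.pi * Complex.I * (pairing M a b : ℂ))

theorem digitChar_add_left (a a' b : Fin d → ℤ) :
    digitChar M (a + a') b = digitChar M a b * digitChar M a' b := by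
  rw [digitChar, pairing_add_left, Complex.ofReal_add, mul_add, Complex.exp_add]
  rfl

theorem digitChar_add_right (a b b' : Fin d → ℤ) :
    digitChar M a (b + b') = digitChar M a b * digitChar M a b' := by
  rw [digitChar, pairing_add_right, Complex.ofReal_add, mul_add, Complex.exp_add]
  rfl

theorem digitChar_eq_one_of_int {a b : Fin d → ℤ} {n : ℤ} (h : pairing M a b = n) :
    digitChar M a b = 1 := by
  rw [digitChar, h, Complex.exp_eq_one_iff]
  exact ⟨n, by push_cast; ring⟩

theorem digitChar_congr_left {a a' : Fin d → ℤ} (h : M.Congruent a a') (b : Fin d → ℤ) :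
    digitChar M a b = digitChar M a' b := by
  obtain ⟨s, hs⟩ := h
  rw [eq_add_of_sub_eq hs, digitChar_add_left,
    digitChar_eq_one_of_int (pairing_lattice_left s b), one_mul]

theorem digitChar_congr_right (a : Fin d → ℤ) {b b' : Fin d → ℤ}
    (h : M.transpose.Congruent b b') : digitChar M a b = digitChar M a b' := by
  obtain ⟨s, hs⟩ := h
  rw [eq_add_of_sub_eq hs, digitChar_add_right,
    digitChar_eq_one_of_int (pairing_lattice_right a s), one_mul]

theorem digitChar_digit_add_left (a a' : D.Digit) (b : Fin d → ℤ) :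
    digitChar M (a + a').1 b = digitChar M a.1 b * digitChar M a'.1 b := by
  rw [digitChar_congr_left (D.add_congruent a a'), digitChar_add_left]

theorem digitChar_digit_add_right (a : Fin d → ℤ) (b b' : E.Digit) :
    digitChar M a (b + b').1 = digitChar M a b.1 * digitChar M a b'.1 := by
  rw [digitChar_congr_right a (E.add_congruent b b'), digitChar_add_right]

theorem digitChar_digit_zero_left (b : Fin d → ℤ) : digitChar M (0 : D.Digit).1 b = 1 := by
  rw [D.zero_val]
  apply digitChar_eq_one_of_int (n := 0)
  simpa using pairing_lattice_left (M := M) 0 b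

theorem digitChar_digit_zero_right (a : Fin d → ℤ) : digitChar M a (0 : E.Digit).1 = 1 := by
  rw [E.zero_val]
  apply digitChar_eq_one_of_int (n := 0)
  simpa using pairing_lattice_right (M := M) a 0

/-- The pairing of digits is nondegenerate. -/
theorem eq_zero_of_digitChar_eq_one (a : D.Digit)
    (h : ∀ b : E.Digit, digitChar M a.1 b.1 = 1) : a = 0 := by
  have hall : ∀ b : Fin d → ℤ, digitChar M a.1 b = 1 := by
    intro b
    obtain ⟨b', hb'⟩ := E.toQuotient_bijective.2 (Submodule.Quotient.mk b)
    rw [← digitChar_congr_right a.1 ((M.transpose.mk_eq_iff _ _).mp hb')]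
    exact h b'
  -- Testing against the unit vectors shows that M⁻¹a is an integer vector s, so a = Ms is congruent
  -- to 0.
  have hint : ∀ i, ∃ n : ℤ,
      ((M.mat.map (Int.cast : ℤ → ℝ))⁻¹ *ᵥ (fun i => (a.1 i : ℝ))) i = n := by
    intro i
    obtain ⟨n, hn⟩ := Complex.exp_eq_one_iff.mp (hall (Pi.single i 1))
    refine ⟨n, ?_⟩
    have h2 : (2 * Real.pi * Complex.I : ℂ) ≠ 0 := by
      simp [Real.pi_ne_zero]
    have h3 : (pairing M a.1 (Pi.single i 1) : ℂ) = n := by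
      apply mul_left_cancel₀ h2
      rw [hn]; ring
    have h4 : pairing M a.1 (Pi.single i 1) = n := by exact_mod_cast h3
    rw [← h4, pairing]
    have : (fun j => ((Pi.single i (1 : ℤ) : Fin d → ℤ) j : ℝ)) = Pi.single i 1 := by
      ext j
      by_cases hj : j = i
      · subst hj; simp
      · simp [hj]
    rw [this, dotProduct_single, mul_one]
  choose s hs using hint
  have hMs : M.mat *ᵥ s = a.1 := by
    have h1 : (fun i => ((M.mat *ᵥ s) i : ℝ)) = fun i => (a.1 i : ℝ) := by
      rw [cast_mulVec, ← funext hs, Matrix.mulVec_mulVec,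
        Matrix.mul_nonsing_inv _ (isUnit_det_cast M), Matrix.one_mulVec]
    ext i
    exact_mod_cast congrFun h1 i
  apply D.toQuotient_bijective.1
  refine (M.mk_eq_iff _ _).mpr ⟨s, ?_⟩
  rw [D.zero_val, sub_zero, hMs]

open Classical in
/-- Orthogonality relation for the characters of the group of digits. -/
theorem sum_digitChar (a : D.Digit) :
    ∑ k : Fin M.transpose.m, digitChar M a.1 (E.s k) = if a = 0 then (M.m : ℂ) else 0 := by
  have := Fintype.ofFinite E.Digit
  let ψ : AddChar E.Digit ℂ :=
    { toFun := fun b => digitChar M a.1 b.1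
      map_zero_eq_one' := digitChar_digit_zero_right a.1
      map_add_eq_mul' := digitChar_digit_add_right a.1 }
  have h1 : ∑ k : Fin M.transpose.m, digitChar M a.1 (E.s k) = ∑ b, ψ b :=
    Fintype.sum_bijective E.digit E.digit_bijective _ _ fun _ => rfl
  have hψ : ψ = 0 ↔ a = 0 := by
    constructor
    · intro h
      exact eq_zero_of_digitChar_eq_one a fun b => DFunLike.congr_fun h b
    · rintro rfl
      ext b
      exact digitChar_digit_zero_left b.1
  have hcard : Fintype.card E.Digit = M.m := by
    rw [← M.transpose_m, ← Fintype.card_fin M.transpose.m]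
    exact (Fintype.card_of_bijective E.digit_bijective).symm
  rw [h1, AddChar.sum_eq_ite, hcard]
  simp only [hψ]

/-! ### The pairing χ of V and V* -/

theorem finite_support_pairing (x : V D) (ω : V E) :
    (Function.support fun j : ℤ => pairing M (x.coord j).1 (ω.coord (1 - j)).1).Finite := by
  obtain ⟨N, hN⟩ := x.2
  obtain ⟨K, hK⟩ := ω.2
  refine (Set.finite_Icc N (1 - K)).subset fun j hj => ?_
  by_contra hj'
  apply hj
  rw [Set.mem_Icc, not_and_or, not_le, not_le] at hj'
  rcases hj' with h | h
  · have : x.coord j = 0 := hN j h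
    simp [this, D.zero_val, pairing, dotProduct, Matrix.mulVec]
  · have : ω.coord (1 - j) = 0 := hK _ (by omega)
    simp [this, E.zero_val, pairing, dotProduct]

theorem mulSupport_digitChar_subset (x : V D) (ω : V E) :
    (Function.mulSupport fun j : ℤ => digitChar M (x.coord j).1 (ω.coord (1 - j)).1) ⊆
      Function.support fun j : ℤ => pairing M (x.coord j).1 (ω.coord (1 - j)).1 := by
  intro j hj h
  exact hj (by simp [digitChar, h])

theorem finite_mulSupport_digitChar (x : V D) (ω : V E) :
    (Function.mulSupport fun j : ℤ =>
      digitChar M (x.coord j).1 (ω.coord (1 - j)).1).Finite :=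
  (finite_support_pairing x ω).subset (mulSupport_digitChar_subset x ω)

/-- As a product over coordinates, χ inherits its multiplicativity from the digits. Both sides are
computed over the support of the exponents, which may exceed the support of the product: a nonzero
integer exponent contributes the factor 1. -/
theorem chi_eq_finprod (x : V D) (ω : V E) :
    chi x ω = ∏ᶠ j : ℤ, digitChar M (x.coord j).1 (ω.coord (1 - j)).1 := by
  have hs := finite_support_pairing x ω
  rw [finprod_eq_prod_of_mulSupport_subset (s := hs.toFinset) _
    (by simpa using mulSupport_digitChar_subset x ω)]
  simp only [digitChar]
  rw [← Complex.exp_sum, ← Finset.mul_sum, ← Complex.ofReal_sum,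
    ← finsum_eq_sum_of_support_subset (s := hs.toFinset) _ (by simp)]
  rfl

theorem chi_add_left (x y : V D) (ω : V E) : chi (x + y) ω = chi x ω * chi y ω := by
  simp only [chi_eq_finprod, coord_add, digitChar_digit_add_left]
  exact finprod_mul_distrib (finite_mulSupport_digitChar x ω) (finite_mulSupport_digitChar y ω)

theorem chi_add_right (x : V D) (ω η : V E) : chi x (ω + η) = chi x ω * chi x η := by
  simp only [chi_eq_finprod, coord_add, digitChar_digit_add_right]
  exact finprod_mul_distrib (finite_mulSupport_digitChar x ω) (finite_mulSupport_digitChar x η)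

theorem chi_zero_left (ω : V E) : chi (0 : V D) ω = 1 := by
  simp only [chi_eq_finprod, coord_zero, digitChar_digit_zero_left, finprod_one]

theorem chi_zero_right (x : V D) : chi x (0 : V E) = 1 := by
  simp only [chi_eq_finprod, coord_zero, digitChar_digit_zero_right, finprod_one]

theorem norm_chi (x : V D) (ω : V E) : ‖chi x ω‖ = 1 := by
  have : ∀ r : ℝ, ‖Complex.exp (2 * Real.pi * Complex.I * (r : ℂ))‖ = 1 := fun r => by
    have h : (2 * Real.pi * Complex.I * (r : ℂ)) = ((2 * Real.pi * r : ℝ) : ℂ) * Complex.I := by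
      push_cast; ring
    rw [h, Complex.norm_exp_ofReal_mul_I]
  exact this _

theorem chi_mul_conj (x : V D) (ω : V E) : chi x ω * (starRingEnd ℂ) (chi x ω) = 1 := by
  rw [Complex.mul_conj, Complex.normSq_eq_norm_sq, norm_chi]
  simp

theorem conj_chi (x : V D) (ω : V E) : (starRingEnd ℂ) (chi x ω) = chi (-x) ω := by
  have h : chi x ω * chi (-x) ω = 1 := by
    rw [← chi_add_left, add_neg_cancel, chi_zero_left]
  have h0 : chi x ω ≠ 0 := norm_ne_zero_iff.mp (by rw [norm_chi]; exact one_ne_zero)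
  exact mul_left_cancel₀ h0 ((chi_mul_conj x ω).trans h.symm)

theorem dil_add (x y : V D) : dil (x + y) = dil x + dil y := rfl

theorem coord_dil (x : V D) (j : ℤ) : (dil x).coord j = x.coord (j + 1) := rfl

theorem dil_symm_add (x y : V D) : dil.symm (x + y) = dil.symm x + dil.symm y := rfl

/-- The dilations of `V` and `V*` are adjoint with respect to the pairing. -/
theorem chi_dil (x : V D) (ω : V E) : chi (dil x) ω = chi x (dil ω) := by
  rw [chi_eq_finprod, chi_eq_finprod]
  refine finprod_eq_of_bijective (fun j => j + 1) (Equiv.addRight (1 : ℤ)).bijective fun j => ?_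
  rw [coord_dil, coord_dil]
  congr 3
  ring

/-- The element of `V` whose only possibly nonzero coordinate is the digit `s_i` at place `j`. -/
def single (D : DigitSet M) (j : ℤ) (i : Fin M.m) : V D :=
  ⟨fun l => if l = j then D.digit i else 0, j, fun _ hl => if_neg hl.ne⟩

theorem chi_single (x : V D) (j : ℤ) (k : Fin M.transpose.m) :
    chi x (single E (1 - j) k) = digitChar M (x.coord j).1 (E.s k) := by
  rw [chi_eq_finprod, finprod_eq_single _ j]
  · congr 1
    exact congrArg Subtype.val (if_pos rfl : (if 1 - j = 1 - j then E.digit k else 0) = _)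
  · intro l hl
    have : (single E (1 - j) k).coord (1 - l) = 0 := if_neg (by omega)
    rw [this, digitChar_digit_zero_right]

/-- The shifted digit sits at place 1, hence pairs with coordinate 0 of V. This coordinate alone
decides which terms of the squared mask survive. -/
theorem dil_symm_ofDigit (k : Fin M.m) : dil.symm (ofDigit D k) = single D 1 k := by
  refine ext_coord fun j => ?_
  show (if j - 1 = 0 then D.digit k else 0) = if j = 1 then D.digit k else 0
  simp only [sub_eq_zero]

-- Averaging over one digit of V* detects the vanishing of one coordinate in V. It serves at j = 0
-- for the mask identity and at arbitrary j for injectivity of the Fourier transform.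
open Classical in
theorem sum_chi_single (x : V D) (j : ℤ) :
    ∑ k : Fin M.transpose.m, chi x (single E (1 - j) k) =
      if x.coord j = 0 then (M.m : ℂ) else 0 := by
  simp only [chi_single]
  exact sum_digitChar _

/-! ### Topology of V, Haar measure and the dilation -/

theorem isOpen_coord_eq (j : ℤ) (a : D.Digit) : IsOpen {x : V D | x.coord j = a} := by
  rw [V.isOpen_iff]
  intro x hx
  refine ⟨j, fun u hu => ?_⟩
  rw [Set.mem_ofPred_eq, coord_add, hu j le_rfl, add_zero]
  exact hx

instance : T2Space (V D) where
  t2 x y hxy := by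
    have : ∃ j, x.coord j ≠ y.coord j := by
      by_contra! h
      exact hxy (ext_coord h)
    obtain ⟨j, hj⟩ := this
    refine ⟨_, _, isOpen_coord_eq j (x.coord j), isOpen_coord_eq j (y.coord j), rfl, rfl, ?_⟩
    rw [Set.disjoint_left]
    intro z hz hz'
    exact hj (hz.symm.trans hz')

instance : LocallyCompactSpace (V D) :=
  (compactU D).locallyCompactSpace_of_addGroup

variable (D) in
/-- The dilation as an automorphism of the topological group `V`. -/
def dilEquiv : V D ≃ₜ+ V D where
  toEquiv := dil
  map_add' := dil_add
  continuous_toFun := by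
    rw [continuous_def]
    intro S hS
    rw [V.isOpen_iff] at hS ⊢
    intro x hx
    obtain ⟨l, hl⟩ := hS _ hx
    refine ⟨l + 1, fun u hu => hl (dil u) fun j hj => hu (j + 1) (by omega)⟩
  continuous_invFun := by
    rw [continuous_def]
    intro S hS
    rw [V.isOpen_iff] at hS ⊢
    intro x hx
    obtain ⟨l, hl⟩ := hS _ hx
    refine ⟨l - 1, fun u hu => hl (dil.symm u) fun j hj => hu (j - 1) (by omega)⟩

theorem continuous_dil : Continuous (dil : V D → V D) := (dilEquiv D).continuous_toFun

theorem dil_mem_U_iff {x : V D} {l : ℤ} : dil x ∈ U D l ↔ x ∈ U D (l + 1) := by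
  constructor
  · intro h j hj
    have := h (j - 1) (by omega)
    rwa [coord_dil, sub_add_cancel] at this
  · intro h j hj
    exact h (j + 1) (by omega)

theorem isCompact_U_neg (n : ℕ) : IsCompact (U D (-n) : Set (V D)) := by
  induction n with
  | zero => simpa using isCompact_U (D := D)
  | succ n ih =>
    have : (U D (-(n + 1 : ℕ)) : Set (V D)) = dil '' (U D (-n) : Set (V D)) := by
      ext x
      rw [Equiv.image_eq_preimage_symm, Set.mem_preimage, SetLike.mem_coe, SetLike.mem_coe]
      conv_lhs => rw [← dil.apply_symm_apply x]
      rw [dil_mem_U_iff]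
      push_cast
      rw [neg_add, neg_add_cancel_right]
    rw [this]
    exact ih.image continuous_dil

theorem exists_mem_U_neg (x : V D) : ∃ n : ℕ, x ∈ U D (-n) := by
  obtain ⟨N, hN⟩ := x.2
  exact ⟨(1 - N).toNat, fun j hj => hN j (by omega)⟩

theorem exists_subset_U_neg {K : Set (V D)} (hK : IsCompact K) :
    ∃ n : ℕ, K ⊆ (U D (-n) : Set (V D)) := by
  refine hK.elim_directed_cover (fun n : ℕ => (U D (-n) : Set (V D))) (fun n => isOpen_U _)
    (fun x _ => Set.mem_iUnion.mpr (exists_mem_U_neg x)) ?_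
  refine directed_of_isDirected_le fun a b hab => ?_
  exact U_anti (by simpa using hab)

instance : SigmaCompactSpace (V D) :=
  ⟨⟨fun n : ℕ => (U D (-n) : Set (V D)), isCompact_U_neg,
    Set.iUnion_eq_univ_iff.mpr exists_mem_U_neg⟩⟩

instance : (haar D).IsAddHaarMeasure :=
  inferInstanceAs (Measure.addHaarMeasure (compactU D)).IsAddHaarMeasure

instance : (haar D).Regular :=
  inferInstanceAs (Measure.addHaarMeasure (compactU D)).Regular

theorem measurable_coord_eq (j : ℤ) (a : D.Digit) : MeasurableSet {x : V D | x.coord j = a} :=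
  (isOpen_coord_eq j a).measurableSet

/-- U_0 is the disjoint union of m translates of U_1, one for each value of the first coordinate. -/
theorem m_mul_haar_U_one : (M.m : ENNReal) * haar D (U D 1 : Set (V D)) = 1 := by
  have hU : (U D 0 : Set (V D)) = ⋃ i ∈ (Finset.univ : Finset (Fin M.m)),
      (fun x => x + -single D 1 i) ⁻¹' (U D 1 : Set (V D)) := by
    have hcoord : ∀ i l, (single D 1 i).coord l = if l = 1 then D.digit i else 0 :=
      fun _ _ => rfl
    ext x
    simp only [Finset.mem_univ, Set.iUnion_true, Set.mem_iUnion, Set.mem_preimage,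
      SetLike.mem_coe]
    constructor
    · intro hx
      obtain ⟨i, hi⟩ := D.digit_bijective.2 (x.coord 1)
      refine ⟨i, fun j hj => ?_⟩
      rw [coord_add, coord_neg, hcoord]
      split_ifs with h
      · rw [h, hi, add_neg_cancel]
      · rw [hx j (by omega), neg_zero, add_zero]
    · rintro ⟨i, hi⟩ j hj
      have := hi j (by omega)
      rwa [coord_add, coord_neg, hcoord, if_neg (by omega), neg_zero, add_zero] at this
  have hdisj : Set.PairwiseDisjoint (↑(Finset.univ : Finset (Fin M.m)))
      fun i => (fun x => x + -single D 1 i) ⁻¹' (U D 1 : Set (V D)) := by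
    intro i _ k _ hik
    rw [Function.onFun, Set.disjoint_left]
    intro x hx hx'
    apply hik
    apply D.digit_bijective.1
    have h1 : x.coord 1 + -D.digit i = 0 := hx 1 le_rfl
    have h2 : x.coord 1 + -D.digit k = 0 := hx' 1 le_rfl
    rw [← sub_eq_add_neg, sub_eq_zero] at h1 h2
    rw [← h1, h2]
  have h := haar_U (D := D)
  rw [hU, measure_biUnion_finset hdisj fun i _ =>
    ((continuous_add_const _).isOpen_preimage _ (isOpen_U 1)).measurableSet] at h
  simpa [measure_preimage_add_right] using h

/-- The dilation changes the Haar measure by the factor `m`. -/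
theorem m_smul_map_dil : (M.m : NNReal) • (haar D).map dil = haar D := by
  have h := addEquivAddHaarChar_smul_map (haar D) (dilEquiv D)
  have hcoe : (⇑(dilEquiv D) : V D → V D) = dil := rfl
  rw [hcoe] at h
  have hpre : dil ⁻¹' (U D 0 : Set (V D)) = (U D 1 : Set (V D)) := by
    ext x
    exact dil_mem_U_iff
  -- Uniqueness of Haar measure gives some scaling factor; evaluation on U_0, whose preimage is U_1,
  -- identifies it.
  have h1 : addEquivAddHaarChar (dilEquiv D) * haar D (U D 1 : Set (V D)) = 1 := by
    have := congrArg (fun ν : Measure (V D) => ν (U D 0)) h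
    simp only [Measure.smul_apply] at this
    rwa [Measure.map_apply continuous_dil.measurable (isOpen_U 0).measurableSet, hpre, haar_U,
      ENNReal.smul_def, smul_eq_mul] at this
  have h2 : (addEquivAddHaarChar (dilEquiv D) : ENNReal) = M.m := by
    rw [ENNReal.eq_inv_of_mul_eq_one_left h1,
      ENNReal.eq_inv_of_mul_eq_one_left (m_mul_haar_U_one (D := D))]
  have h3 : addEquivAddHaarChar (dilEquiv D) = M.m := by exact_mod_cast h2
  rwa [h3] at h

theorem integral_comp_dil (f : V D → ℂ) :
    ∫ x, f (dil x) ∂haar D = (M.m : ℂ)⁻¹ * ∫ x, f x ∂haar D := by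
  have hm : (M.m : ℂ) ≠ 0 := by exact_mod_cast M.m_pos.ne'
  have h : ∫ x, f x ∂haar D = M.m * ∫ x, f (dil x) ∂haar D := by
    conv_lhs => rw [← m_smul_map_dil (D := D)]
    have h1 : ∫ x, f x ∂(haar D).map dil = ∫ x, f (dil x) ∂haar D :=
      (dilEquiv D).toHomeomorph.measurableEmbedding.integral_map f
    rw [integral_smul_nnreal_measure, h1]
    simp [NNReal.smul_def]
  rw [h, inv_mul_cancel_left₀ hm]

/-! ### The Fourier transform -/

theorem continuous_chi (ω : V E) : Continuous fun x : V D => chi x ω := by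
  refine IsLocallyConstant.continuous ((IsLocallyConstant.iff_exists_open _).mpr fun x => ?_)
  obtain ⟨N, hN⟩ := ω.2
  -- If ω vanishes below N, then χ(u, ω) involves only the coordinates of u up to 1 - N, so χ(·, ω)
  -- is constant on cosets of U_{1-N}.
  refine ⟨{y | y - x ∈ U D (1 - N)}, isOpen_coset x _, by simp [zero_mem], fun y hy => ?_⟩
  have h1 : chi (y - x) ω = 1 := by
    rw [chi_eq_finprod]
    refine finprod_eq_one_of_forall_eq_one fun j => ?_
    by_cases hj : j ≤ 1 - N
    · rw [hy j hj, digitChar_digit_zero_left]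
    · have : ω.coord (1 - j) = 0 := hN _ (by omega)
      rw [this, digitChar_digit_zero_right]
  rw [← sub_add_cancel y x, chi_add_left, h1, one_mul]

theorem integrable_mul_conj_chi {f : V D → ℂ} (hf : Integrable f (haar D)) (ω : V E) :
    Integrable (fun x => f x * (starRingEnd ℂ) (chi x ω)) (haar D) := by
  refine hf.mul_bdd (c := 1) ?_ (Eventually.of_forall fun x => ?_)
  · exact (Complex.continuous_conj.comp (continuous_chi ω)).aestronglyMeasurable
  · rw [RCLike.norm_conj, norm_chi]

/-- The Fourier transform turns a translation into a multiplication by a character. -/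
theorem fourier_translate (f : V D → ℂ) (a : V D) (ω : V E) :
    fourier E (fun x => f (x + a)) ω = chi a ω * fourier E f ω := by
  rw [fourier, fourier, ← integral_add_right_eq_self _ (-a), ← integral_const_mul]
  refine integral_congr_ae (Eventually.of_forall fun x => ?_)
  simp only
  rw [neg_add_cancel_right, chi_add_left, map_mul, conj_chi (-a), neg_neg]
  ring

/-- The Fourier transform of a dilated function. -/
theorem fourier_dil (f : V D → ℂ) (ω : V E) :
    fourier E (fun x => f (dil x)) ω = (M.m : ℂ)⁻¹ * fourier E f (dil.symm ω) := by
  rw [fourier, fourier, ← integral_comp_dil]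
  simp only [chi_dil, Equiv.apply_symm_apply]

/-! ### The elements γ_[k] and m-ary digits -/

theorem coord_gam_neg (k j : ℕ) :
    (gam D k).coord (-j) = D.digit ⟨k / M.m ^ j % M.m, Nat.mod_lt _ M.m_pos⟩ := by
  have h : (gam D k).coord (-j) =
      D.digit ⟨k / M.m ^ (-(-(j : ℤ))).toNat % M.m, Nat.mod_lt _ M.m_pos⟩ := if_pos (by omega)
  simpa using h

theorem gam_mem_H (k : ℕ) : gam D k ∈ H D := fun _ hj => if_neg (by omega)

theorem coord_gam_eq_zero_iff (k j : ℕ) :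
    (gam D k).coord (-j) = 0 ↔ k / M.m ^ j % M.m = 0 := by
  rw [coord_gam_neg, ← D.digit_zero, D.digit_bijective.1.eq_iff, Fin.mk.injEq]

theorem gam_mem_U {k n : ℕ} (hk : k < M.m ^ n) : gam D k ∈ U D (-n) := by
  intro i hi
  obtain ⟨j, rfl⟩ : ∃ j : ℕ, i = -j := ⟨(-i).toNat, by omega⟩
  rw [coord_gam_eq_zero_iff, Nat.div_eq_of_lt, Nat.zero_mod]
  exact hk.trans_le (Nat.pow_le_pow_right M.m_pos (by omega))

theorem eq_zero_of_forall_digit_eq_zero {b k : ℕ} (hb : 1 < b)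
    (h : ∀ j, k / b ^ j % b = 0) : k = 0 := by
  induction k using Nat.strong_induction_on with
  | _ k ih =>
    by_contra hk
    have h1 : k / b = 0 := by
      refine ih _ (Nat.div_lt_self (Nat.pos_of_ne_zero hk) hb) fun j => ?_
      rw [Nat.div_div_eq_div_mul, ← pow_succ']
      exact h (j + 1)
    have h2 := h 0
    rw [pow_zero, Nat.div_one] at h2
    exact hk (by rw [← Nat.div_add_mod k b, h1, h2, mul_zero])

theorem lt_of_gam_mem_U (hm : 1 < M.m) {k n : ℕ} (h : gam D k ∈ U D (-n)) : k < M.m ^ n := by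
  have : k / M.m ^ n = 0 := by
    refine eq_zero_of_forall_digit_eq_zero hm fun j => ?_
    rw [Nat.div_div_eq_div_mul, ← pow_add]
    exact (coord_gam_eq_zero_iff (D := D) k (n + j)).mp (h _ (by push_cast; omega))
  exact (Nat.div_eq_zero_iff_lt (pow_pos M.m_pos n)).mp this

/-- Induction on the number of digits, stripping the last one. The common bound b ^ n makes 1 < b
unnecessary. -/
theorem eq_of_forall_digit_eq {b n : ℕ} : ∀ {k l : ℕ}, k < b ^ n → l < b ^ n →
    (∀ j, k / b ^ j % b = l / b ^ j % b) → k = l := by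
  induction n with
  | zero => intro k l hk hl _; simp at hk hl; omega
  | succ n ih =>
    intro k l hk hl h
    have h1 : k / b = l / b := by
      refine ih (Nat.div_lt_of_lt_mul (by rwa [← pow_succ']))
        (Nat.div_lt_of_lt_mul (by rwa [← pow_succ'])) fun j => ?_
      rw [Nat.div_div_eq_div_mul, Nat.div_div_eq_div_mul, ← pow_succ']
      exact h (j + 1)
    have h2 := h 0
    rw [pow_zero, Nat.div_one, Nat.div_one] at h2
    rw [← Nat.div_add_mod k b, ← Nat.div_add_mod l b, h1, h2]

theorem gam_injOn (n : ℕ) : Set.InjOn (gam D) {k | k < M.m ^ n} := by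
  intro k hk l hl h
  refine eq_of_forall_digit_eq hk hl fun j => ?_
  have := congrArg (fun x : V D => x.coord (-j)) h
  simpa [coord_gam_neg, D.digit_bijective.1.eq_iff] using this

/-! ### Injectivity of the Fourier transform -/

/-- If the Fourier transform of `g` vanishes, then so do the integrals of `g` times a character
over all sets given by finitely many coordinates. -/
theorem setIntegral_cylinder_eq_zero {g : V D → ℂ} (hg : Integrable g (haar D))
    (h0 : ∀ ω : V E, fourier E g ω = 0) (J : Finset ℤ) (a : ℤ → D.Digit) (ω : V E) :
    ∫ x in {x : V D | ∀ j ∈ J, x.coord j = a j},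
      g x * (starRingEnd ℂ) (chi x ω) ∂haar D = 0 := by
  classical
  -- Prescribing one more coordinate replaces the character at ω by an average over its shifts by a
  -- digit, so the induction must run over all ω.
  induction J using Finset.induction_on generalizing ω with
  | empty => simpa [fourier] using h0 ω
  | insert j J _ ih =>
    have hm : (M.m : ℂ) ≠ 0 := by exact_mod_cast M.m_pos.ne'
    have hset : {x : V D | ∀ i ∈ insert j J, x.coord i = a i} =
        {x : V D | ∀ i ∈ J, x.coord i = a i} ∩ {x | x.coord j = a j} := by
      ext x
      simp [and_comm]
    let y : V D := ⟨fun i => if i = j then a j else 0, j, fun i hi => if_neg hi.ne⟩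
    have hy : y.coord j = a j := if_pos rfl
    -- The indicator of x_j = a_j is m⁻¹ ∑_k χ(y - x, ·) over the digits at place 1 - j, where y
    -- carries a_j at place j.
    have hind : ∀ x : V D, Set.indicator {x | x.coord j = a j}
        (fun x => g x * (starRingEnd ℂ) (chi x ω)) x =
        ∑ k : Fin M.transpose.m, (M.m : ℂ)⁻¹ * chi y (single E (1 - j) k) *
          (g x * (starRingEnd ℂ) (chi x (ω + single E (1 - j) k))) := by
      intro x
      have hsum := sum_chi_single (E := E) (y - x) j
      have hterm : ∀ k : Fin M.transpose.m, (M.m : ℂ)⁻¹ * chi y (single E (1 - j) k) *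
          (g x * (starRingEnd ℂ) (chi x (ω + single E (1 - j) k))) =
          (M.m : ℂ)⁻¹ * (g x * (starRingEnd ℂ) (chi x ω)) * chi (y - x) (single E (1 - j) k) := by
        intro k
        rw [chi_add_right, map_mul, conj_chi x (single E (1 - j) k), sub_eq_add_neg y x,
          chi_add_left]
        ring
      have hiff : (y - x).coord j = 0 ↔ x.coord j = a j := by
        rw [sub_eq_add_neg, coord_add, coord_neg, ← sub_eq_add_neg, sub_eq_zero, hy, eq_comm]
      rw [Finset.sum_congr rfl fun k _ => hterm k, ← Finset.mul_sum, hsum]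
      simp only [hiff, Set.indicator, Set.mem_ofPred_eq]
      split_ifs
      · rw [mul_comm (M.m : ℂ)⁻¹, mul_assoc, inv_mul_cancel₀ hm, mul_one]
      · rw [mul_zero]
    rw [hset, ← setIntegral_indicator (measurable_coord_eq j (a j))]
    simp only [hind]
    rw [integral_finsetSum _ fun k _ => ((integrable_mul_conj_chi hg _).const_mul _).integrableOn]
    refine Finset.sum_eq_zero fun k _ => ?_
    rw [integral_const_mul, ih, mul_zero]

/-- The points of `V` that agree with a point of `K` at the places from `-l` to `l`. -/
def cylinderHull (K : Set (V D)) (l : ℕ) : Set (V D) :=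
  {x | ∃ y ∈ K, ∀ j ∈ Finset.Icc (-l : ℤ) l, x.coord j = y.coord j}

theorem isOpen_cylinder (J : Finset ℤ) (a : ℤ → D.Digit) :
    IsOpen {x : V D | ∀ j ∈ J, x.coord j = a j} := by
  have : {x : V D | ∀ j ∈ J, x.coord j = a j} = ⋂ j ∈ J, {x | x.coord j = a j} := by
    ext x
    simp
  rw [this]
  exact isOpen_biInter_finset fun j _ => isOpen_coord_eq j (a j)

theorem isOpen_cylinderHull (K : Set (V D)) (l : ℕ) : IsOpen (cylinderHull K l) := by
  have : cylinderHull K l =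
      ⋃ y ∈ K, {x : V D | ∀ j ∈ Finset.Icc (-l : ℤ) l, x.coord j = y.coord j} := by
    ext x
    simp [cylinderHull]
  rw [this]
  exact isOpen_biUnion fun y _ => isOpen_cylinder _ y.coord

theorem cylinderHull_antitone (K : Set (V D)) : Antitone (cylinderHull K) := by
  rintro k l hkl x ⟨y, hy, h⟩
  refine ⟨y, hy, fun j hj => h j ?_⟩
  rw [Finset.mem_Icc] at hj ⊢
  omega

theorem iInter_cylinderHull {K : Set (V D)} (hK : IsCompact K) :
    ⋂ l, cylinderHull K l = K := by
  apply Set.Subset.antisymm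
  · intro x hx
    rw [Set.mem_iInter] at hx
    obtain ⟨n, hn⟩ := exists_subset_U_neg hK
    obtain ⟨p, hp⟩ := exists_mem_U_neg x
    rw [← hK.isClosed.closure_eq, mem_closure_iff]
    intro S hS hxS
    obtain ⟨l, hl⟩ := V.isOpen_iff.mp hS x hxS
    -- The window reaches up to l, and down to where x and all points of K vanish; hence y - x lies
    -- in U_l.
    obtain ⟨y, hy, h⟩ := hx (max l.toNat (max n p))
    refine ⟨y, ?_, hy⟩
    rw [← add_sub_cancel x y]
    refine hl _ fun j hj => ?_
    rw [sub_eq_add_neg, coord_add, coord_neg, ← sub_eq_add_neg, sub_eq_zero]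
    by_cases hj' : j ≤ -(max n p : ℕ)
    · rw [hn hy j (by push_cast at hj'; omega), hp j (by push_cast at hj'; omega)]
    · exact (h j (by rw [Finset.mem_Icc]; push_cast at hj' ⊢; omega)).symm
  · exact Set.subset_iInter fun l x hx => ⟨x, hx, fun _ _ => rfl⟩

/-- Only finitely many digit patterns occur on the window, so the hull is a finite disjoint union of
cylinders, each handled with ω = 0. -/
theorem setIntegral_cylinderHull_eq_zero {g : V D → ℂ} (hg : Integrable g (haar D))
    (h0 : ∀ ω : V E, fourier E g ω = 0) (K : Set (V D)) (l : ℕ) :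
    ∫ x in cylinderHull K l, g x ∂haar D = 0 := by
  classical
  let J := Finset.Icc (-l : ℤ) l
  let r : V D → (J → D.Digit) := fun x j => x.coord j
  let ext : (J → D.Digit) → ℤ → D.Digit := fun t j => if h : j ∈ J then t ⟨j, h⟩ else 0
  have hcyl : ∀ t, {x : V D | ∀ j ∈ J, x.coord j = ext t j} = r ⁻¹' {t} := by
    intro t
    ext x
    simp only [Set.mem_ofPred_eq, Set.mem_preimage, Set.mem_singleton_iff, funext_iff,
      Subtype.forall]
    refine forall₂_congr fun j hj => ?_
    simp [ext, r, hj]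
  have hT : (r '' K).Finite := Set.toFinite _
  have hhull : cylinderHull K l = ⋃ t ∈ hT.toFinset, r ⁻¹' {t} := by
    ext x
    simp only [cylinderHull, Set.mem_ofPred_eq, Set.Finite.mem_toFinset, Set.mem_image,
      Set.mem_iUnion, Set.mem_preimage, Set.mem_singleton_iff, exists_prop]
    constructor
    · rintro ⟨y, hy, h⟩
      exact ⟨r x, ⟨y, hy, funext fun j => (h j j.2).symm⟩, rfl⟩
    · rintro ⟨t, ⟨y, hy, hyt⟩, hxt⟩
      exact ⟨y, hy, fun j hj => congrFun (hxt.trans hyt.symm) ⟨j, hj⟩⟩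
  rw [hhull, integral_biUnion_finset]
  · refine Finset.sum_eq_zero fun t _ => ?_
    have := setIntegral_cylinder_eq_zero hg h0 J (ext t) 0
    simpa [chi_zero_right, hcyl t] using this
  · intro t _
    rw [← hcyl t]
    exact (isOpen_cylinder _ _).measurableSet
  · intro s _ t _ hst
    exact Disjoint.preimage r (by simpa using hst)
  · exact fun _ _ => hg.integrableOn

/-- Injectivity of the Fourier transform. -/
theorem ae_eq_zero_of_fourier_eq_zero {g : V D → ℂ} (hg : Integrable g (haar D))
    (h0 : ∀ ω : V E, fourier E g ω = 0) : g =ᵐ[haar D] 0 := by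
  refine ae_eq_zero_of_forall_setIntegral_isCompact_eq_zero hg fun K hK => ?_
  -- The hulls decrease to the compact set K, so the integral over K is a limit of zeros.
  have h := tendsto_setIntegral_of_antitone (μ := haar D) (f := g)
    (fun l => (isOpen_cylinderHull K l).measurableSet) (cylinderHull_antitone K)
    ⟨0, hg.integrableOn⟩
  simp only [setIntegral_cylinderHull_eq_zero hg h0, iInter_cylinderHull hK] at h
  exact (tendsto_nhds_unique h tendsto_const_nhds)

/-! ### The finite refinement equation and its coefficients -/

theorem integrable_of_memLp_two {φ : V D → ℂ} (hφ : MemLp φ 2 (haar D))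
    (hs : HasCompactSupport φ) : Integrable φ (haar D) := by
  rw [← integrableOn_iff_integrable_of_support_subset (subset_tsupport φ)]
  have : IsFiniteMeasure ((haar D).restrict (tsupport φ)) :=
    ⟨by rw [Measure.restrict_apply_univ]; exact hs.isCompact.measure_lt_top⟩
  exact (hφ.restrict (tsupport φ)).integrable (by norm_num)

/-- For a compactly supported function the refinement equation has finitely many terms. -/
theorem IsRefinable.exists_finite_sum (hm : 1 < M.m) {φ : V D → ℂ} (hφ : IsRefinable φ)
    (hs : HasCompactSupport φ) :
    ∃ (n : ℕ) (α : ℕ → ℂ), ∀ᵐ x ∂haar D,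
      φ x = ∑ k ∈ Finset.range (M.m ^ n), α k * φ (dil x + gam D k) := by
  obtain ⟨-, α, hα⟩ := hφ
  obtain ⟨N, hN⟩ := exists_subset_U_neg hs.isCompact
  have hzero : ∀ x, x ∉ U D (-N) → φ x = 0 := fun x hx =>
    image_eq_zero_of_notMem_tsupport fun h => hx (hN h)
  have hle : U D (-N) ≤ U D (-(N + 1 : ℕ)) := U_anti (by push_cast; omega)
  -- With φ supported in U_{-N}, the dilation carries U_{-N} onto the subgroup U_{-(N+1)}, which
  -- contains γ_[k] exactly for k < m^(N+1).
  refine ⟨N + 1, α, hα.mono fun x hx => ?_⟩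
  have hdil : dil x ∈ U D (-(N + 1 : ℕ)) ↔ x ∈ U D (-N) := by
    rw [dil_mem_U_iff]
    push_cast
    rw [neg_add, neg_add_cancel_right]
  by_cases hxN : x ∈ U D (-N)
  · refine tendsto_nhds_unique hx
      (tendsto_const_nhds.congr' (eventually_atTop.mpr ⟨M.m ^ (N + 1), fun n hn => ?_⟩))
    refine Finset.sum_subset (Finset.range_mono hn) fun k _ hk => ?_
    rw [hzero, mul_zero]
    intro h
    refine hk (Finset.mem_range.mpr (lt_of_gam_mem_U (D := D) hm ?_))
    exact (add_mem_cancel_left (hdil.mpr hxN)).mp (hle h)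
  -- Here 𝓜x lies outside U_{-(N+1)} while the retained γ_[k] lie in it, so every retained term
  -- vanishes, as does φ(x).
  · rw [hzero x hxN]
    refine (Finset.sum_eq_zero fun k hk => ?_).symm
    rw [hzero, mul_zero]
    intro h
    refine hxN (hdil.mp ?_)
    exact (add_mem_cancel_right (gam_mem_U (Finset.mem_range.mp hk))).mp (hle h)

theorem memLp_translate {φ : V D → ℂ} (hφ : MemLp φ 2 (haar D)) (a : V D) :
    MemLp (fun x => φ (x + a)) 2 (haar D) :=
  hφ.comp_measurePreserving (measurePreserving_add_right (haar D) a)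

theorem integrable_mul_conj {f g : V D → ℂ} (hf : MemLp f 2 (haar D))
    (hg : MemLp g 2 (haar D)) :
    Integrable (fun x => f x * (starRingEnd ℂ) (g x)) (haar D) :=
  hf.integrable_mul hg.star

theorem integrable_comp_dil {f : V D → ℂ} (hf : Integrable f (haar D)) :
    Integrable (fun x => f (dil x)) (haar D) := by
  rw [← m_smul_map_dil (D := D)] at hf
  have h1 := (integrable_smul_measure (c := (M.m : ENNReal))
    (by simpa using M.m_pos.ne') (by simp)).mp hf
  exact (dilEquiv D).toHomeomorph.measurableEmbedding.integrable_map_iff.mp h1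

open Classical in
theorem IsOrthogonal.integral_eq_ite {φ : V D → ℂ} (h : IsOrthogonal φ) {a b : V D}
    (ha : a ∈ H D) (hb : b ∈ H D) :
    ∫ x, φ (x + a) * (starRingEnd ℂ) (φ (x + b)) ∂haar D = if a = b then 1 else 0 := by
  split_ifs with hab
  · exact (h a ha b hb).1 hab
  · exact (h a ha b hb).2 hab

theorem zero_mem_H : (0 : V D) ∈ H D := fun _ _ => rfl

theorem add_mem_H {a b : V D} (ha : a ∈ H D) (hb : b ∈ H D) : a + b ∈ H D := fun j hj => by
  rw [coord_add, ha j hj, hb j hj, add_zero]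

theorem dil_mem_H {a : V D} (ha : a ∈ H D) : dil a ∈ H D := fun j hj => ha (j + 1) (by omega)

open Classical in
/-- The relations between the coefficients of the refinement equation of an orthogonal function. -/
theorem IsOrthogonal.sum_coeff {φ : V D → ℂ} (horth : IsOrthogonal φ)
    (hφ : MemLp φ 2 (haar D)) {n : ℕ} {α : ℕ → ℂ}
    (hα : ∀ᵐ x ∂haar D, φ x = ∑ k ∈ Finset.range n, α k * φ (dil x + gam D k))
    {h : V D} (hh : h ∈ H D) :
    ∑ p ∈ Finset.range n ×ˢ Finset.range n with gam D p.1 = dil h + gam D p.2,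
      (M.m : ℂ)⁻¹ * (α p.1 * (starRingEnd ℂ) (α p.2)) = if h = 0 then 1 else 0 := by
  have hα' : ∀ᵐ x ∂haar D,
      φ (x + h) = ∑ l ∈ Finset.range n, α l * φ (dil x + (dil h + gam D l)) := by
    filter_upwards [(measurePreserving_add_right (haar D) h).quasiMeasurePreserving.ae hα]
      with x hx
    simpa only [dil_add, add_assoc] using hx
  have h1 := horth.integral_eq_ite zero_mem_H hh
  simp only [add_zero] at h1
  have hexp : ∀ᵐ x ∂haar D, φ x * (starRingEnd ℂ) (φ (x + h)) =
      ∑ p ∈ Finset.range n ×ˢ Finset.range n, α p.1 * (starRingEnd ℂ) (α p.2) *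
        (φ (dil x + gam D p.1) * (starRingEnd ℂ) (φ (dil x + (dil h + gam D p.2)))) := by
    filter_upwards [hα, hα'] with x hx hx'
    rw [hx, hx', map_sum, Finset.sum_mul_sum, Finset.sum_product]
    refine Finset.sum_congr rfl fun k _ => Finset.sum_congr rfl fun l _ => ?_
    rw [map_mul]
    ring
  -- The change of variables 𝓜x ↦ x costs m⁻¹; both translations belong to H, so orthonormality
  -- applies.
  have hterm : ∀ k l, ∫ x, φ (dil x + gam D k) *
      (starRingEnd ℂ) (φ (dil x + (dil h + gam D l))) ∂haar D =
      (M.m : ℂ)⁻¹ * if gam D k = dil h + gam D l then 1 else 0 := by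
    intro k l
    rw [integral_comp_dil fun y => φ (y + gam D k) * (starRingEnd ℂ) (φ (y + (dil h + gam D l))),
      horth.integral_eq_ite (gam_mem_H k) (add_mem_H (dil_mem_H hh) (gam_mem_H l))]
  rw [integral_congr_ae hexp, integral_finsetSum] at h1
  · simp only [integral_const_mul, hterm] at h1
    rw [Finset.sum_filter]
    simp only [eq_comm (a := h)]
    rw [← h1]
    refine Finset.sum_congr rfl fun p _ => ?_
    split_ifs <;> ring
  · intro p _
    refine Integrable.const_mul ?_ _
    exact integrable_comp_dil (f := fun y => φ (y + gam D p.1) *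
      (starRingEnd ℂ) (φ (y + (dil h + gam D p.2)))) (integrable_mul_conj (memLp_translate hφ (gam D p.1))
      (memLp_translate hφ (dil h + gam D p.2)))

/-! ### Existence of the mask and the identity for its squares -/

/-- The mask attached to the coefficients `α_k` of a refinement equation. -/
def coeffMask (D : DigitSet M) (E : DigitSet M.transpose) (n : ℕ) (α : ℕ → ℂ) (ω : V E) : ℂ :=
  ∑ k ∈ Finset.range (M.m ^ n), (M.m : ℂ)⁻¹ * α k * walsh D E k ω

theorem isMask_coeffMask {φ : V D → ℂ} (hφ : Integrable φ (haar D)) {n : ℕ} {α : ℕ → ℂ}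
    (hα : ∀ᵐ x ∂haar D, φ x = ∑ k ∈ Finset.range (M.m ^ n), α k * φ (dil x + gam D k)) :
    IsMask φ (coeffMask D E n α) := by
  refine ⟨⟨n, fun k => (M.m : ℂ)⁻¹ * α k, fun _ => rfl⟩, fun ω => ?_⟩
  have hint : ∀ k, Integrable (fun x => φ (dil x + gam D k)) (haar D) := fun k =>
    integrable_comp_dil (f := fun y => φ (y + gam D k)) (hφ.comp_add_right (gam D k))
  have h1 : fourier E φ ω = ∑ k ∈ Finset.range (M.m ^ n),
      α k * fourier E (fun x => φ (dil x + gam D k)) ω := by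
    simp only [fourier, ← integral_const_mul]
    rw [← integral_finsetSum _ fun k _ => (integrable_mul_conj_chi (hint k) ω).const_mul _]
    refine integral_congr_ae (hα.mono fun x hx => ?_)
    simp only
    rw [hx, Finset.sum_mul]
    simp only [mul_assoc]
  rw [h1, coeffMask, Finset.sum_mul]
  refine Finset.sum_congr rfl fun k _ => ?_
  rw [fourier_dil fun y => φ (y + gam D k), fourier_translate, walsh]
  ring

theorem sum_norm_sq_coeffMask {φ : V D → ℂ} (horth : IsOrthogonal φ)
    (hφ : MemLp φ 2 (haar D)) {n : ℕ} {α : ℕ → ℂ}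
    (hα : ∀ᵐ x ∂haar D, φ x = ∑ k ∈ Finset.range (M.m ^ n), α k * φ (dil x + gam D k))
    (ω : V E) :
    ∑ i : Fin M.transpose.m, ‖coeffMask D E n α (dil.symm (ω + ofDigit E i))‖ ^ 2 = 1 := by
  classical
  have hm : (M.m : ℂ) ≠ 0 := by exact_mod_cast M.m_pos.ne'
  let B : ℕ × ℕ → ℂ := fun p => (M.m : ℂ)⁻¹ * (α p.1 * (starRingEnd ℂ) (α p.2))
  -- Since the dilations are adjoint, χ(γ_k - γ_l, 𝓜*⁻¹ω) = χ(h, ω) for this h.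
  let h : ℕ × ℕ → V D := fun p => dil.symm (gam D p.1 - gam D p.2)
  let R := Finset.range (M.m ^ n) ×ˢ Finset.range (M.m ^ n)
  have hdil : ∀ p, gam D p.1 - gam D p.2 = dil (h p) := fun p => (dil.apply_symm_apply _).symm
  have hexp : ∀ i : Fin M.transpose.m,
      ((‖coeffMask D E n α (dil.symm (ω + ofDigit E i))‖ ^ 2 : ℝ) : ℂ) =
      ∑ p ∈ R, (M.m : ℂ)⁻¹ * B p * chi (h p) ω *
        chi (gam D p.1 - gam D p.2) (single E (1 - 0) i) := by
    intro i
    rw [← Complex.normSq_eq_norm_sq, ← Complex.mul_conj, coeffMask, map_sum,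
      Finset.sum_mul_sum, Finset.sum_product]
    refine Finset.sum_congr rfl fun k _ => Finset.sum_congr rfl fun l _ => ?_
    have hchi : chi (h (k, l)) ω = chi (gam D k) (dil.symm ω) *
        (starRingEnd ℂ) (chi (gam D l) (dil.symm ω)) := by
      rw [conj_chi, ← chi_add_left, ← sub_eq_add_neg, hdil (k, l), chi_dil,
        Equiv.apply_symm_apply]
    rw [hchi, sub_eq_add_neg (gam D k), chi_add_left, ← conj_chi, dil_symm_add, dil_symm_ofDigit,
      walsh, walsh, chi_add_right, chi_add_right]
    simp only [map_mul, map_inv₀, map_natCast, B, sub_zero]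
    ring
  -- Summation over i yields m, cancelling one of the two factors m⁻¹, when the 0-th coordinate of
  -- γ_k - γ_l vanishes, and 0 otherwise. That coordinate is the first coordinate of h, the only
  -- positive place where h can be nonzero.
  have hsum : (((∑ i : Fin M.transpose.m,
      ‖coeffMask D E n α (dil.symm (ω + ofDigit E i))‖ ^ 2 : ℝ)) : ℂ) =
      ∑ p ∈ R with h p ∈ H D, B p * chi (h p) ω := by
    rw [Complex.ofReal_sum, Finset.sum_congr rfl fun i _ => hexp i, Finset.sum_comm,
      Finset.sum_filter]
    refine Finset.sum_congr rfl fun p _ => ?_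
    rw [← Finset.mul_sum, sum_chi_single]
    have hiff : (gam D p.1 - gam D p.2).coord 0 = 0 ↔ h p ∈ H D := by
      constructor
      · intro h0 j hj
        by_cases hj1 : j = 1
        · subst hj1; exact h0
        · show (gam D p.1 - gam D p.2).coord (j - 1) = 0
          rw [sub_eq_add_neg, coord_add, coord_neg, gam_mem_H p.1 _ (by omega),
            gam_mem_H p.2 _ (by omega), neg_zero, add_zero]
      · intro hH
        exact hH 1 one_pos
    simp only [hiff]
    split_ifs
    · field_simp
    · rw [mul_zero]
  have hone : ∑ p ∈ R with h p ∈ H D, B p * chi (h p) ω = 1 := by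
    rw [← Finset.sum_fiberwise_of_maps_to (t := (R.filter fun p => h p ∈ H D).image h)
      fun p hp => Finset.mem_image_of_mem h hp]
    -- On the fibre over g the character is constant and the coefficients add up to the relation
    -- `IsOrthogonal.sum_coeff` for h = g.
    have hfib : ∀ g ∈ H D, ∑ p ∈ R.filter (fun p => h p ∈ H D) with h p = g,
        B p * chi (h p) ω = (if g = 0 then 1 else 0) * chi g ω := by
      intro g hg
      rw [← horth.sum_coeff hφ hα hg, Finset.sum_mul, Finset.filter_filter]
      refine Finset.sum_congr (Finset.filter_congr fun p _ => ?_) fun p hp => ?_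
      · rw [← sub_eq_iff_eq_add, hdil, dil.apply_eq_iff_eq]
        exact ⟨fun hp => hp.2, fun hp => ⟨hp ▸ hg, hp⟩⟩
      · rw [Finset.mem_filter, ← sub_eq_iff_eq_add, hdil, dil.apply_eq_iff_eq] at hp
        rw [hp.2]
    have hmem : ∀ g ∈ (R.filter fun p => h p ∈ H D).image h, g ∈ H D := by
      intro g hg
      obtain ⟨p, hp, rfl⟩ := Finset.mem_image.mp hg
      exact (Finset.mem_filter.mp hp).2
    -- The pair (0, 0) guarantees that the fibre over 0, the only one contributing, really occurs in
    -- the sum.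
    have h00 : h (0, 0) = 0 := by
      show dil.symm (gam D 0 - gam D 0) = 0
      rw [sub_self]
      rfl
    have hpos : 0 < M.m ^ n := pow_pos M.m_pos n
    rw [Finset.sum_congr rfl fun g hg => hfib g (hmem g hg), Finset.sum_eq_single (0 : V D)]
    · rw [if_pos rfl, chi_zero_left, one_mul]
    · intro g _ hg
      rw [if_neg hg, zero_mul]
    · intro hn
      refine absurd (Finset.mem_image.mpr ⟨(0, 0), Finset.mem_filter.mpr ⟨?_, ?_⟩, h00⟩) hn
      · exact Finset.mk_mem_product (Finset.mem_range.mpr hpos) (Finset.mem_range.mpr hpos)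
      · rw [h00]
        exact zero_mem_H
  rw [hone] at hsum
  exact_mod_cast hsum

/-! ### Uniqueness of the mask -/

/-- The inner product with φ(· ⊕ γ_[l]) isolates c_l, because γ_[k] determines k in the range k <
m^n. -/
theorem IsOrthogonal.coeff_eq_zero {φ : V D → ℂ} (horth : IsOrthogonal φ)
    (hφ : MemLp φ 2 (haar D)) {n : ℕ} {c : ℕ → ℂ}
    (h0 : (fun x => ∑ k ∈ Finset.range (M.m ^ n), c k * φ (x + gam D k)) =ᵐ[haar D] 0)
    {l : ℕ} (hl : l < M.m ^ n) : c l = 0 := by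
  classical
  have h1 : ∫ x, (∑ k ∈ Finset.range (M.m ^ n), c k * φ (x + gam D k)) *
      (starRingEnd ℂ) (φ (x + gam D l)) ∂haar D = 0 := by
    refine integral_eq_zero_of_ae (h0.mono fun x hx => ?_)
    simp only at hx ⊢
    rw [hx]
    simp
  simp only [Finset.sum_mul, mul_assoc] at h1
  rw [integral_finsetSum _ fun k _ => (integrable_mul_conj (memLp_translate hφ (gam D k))
    (memLp_translate hφ (gam D l))).const_mul _] at h1
  simp only [integral_const_mul, horth.integral_eq_ite (gam_mem_H _) (gam_mem_H l)] at h1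
  rw [Finset.sum_eq_single l] at h1
  · simpa using h1
  · intro k hk hkl
    rw [if_neg fun h => hkl (gam_injOn n (Finset.mem_range.mp hk) hl h), mul_zero]
  · intro h
    exact absurd (Finset.mem_range.mpr hl) h

theorem IsWalshPolynomial.exists_common {p q : V E → ℂ} (hp : IsWalshPolynomial D E p)
    (hq : IsWalshPolynomial D E q) : ∃ (n : ℕ) (c : ℕ → ℂ),
      ∀ ω, p ω - q ω = ∑ k ∈ Finset.range (M.m ^ n), c k * walsh D E k ω := by
  have key : ∀ (c : ℕ → ℂ) (a b : ℕ), a ≤ b → ∀ ω : V E,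
      ∑ k ∈ Finset.range (M.m ^ a), c k * walsh D E k ω =
      ∑ k ∈ Finset.range (M.m ^ b), (if k < M.m ^ a then c k else 0) * walsh D E k ω := by
    intro c a b hab ω
    rw [← Finset.sum_subset (Finset.range_mono (Nat.pow_le_pow_right M.m_pos hab))]
    · exact Finset.sum_congr rfl fun k hk => by rw [if_pos (Finset.mem_range.mp hk)]
    · intro k _ hk
      rw [if_neg fun h => hk (Finset.mem_range.mpr h), zero_mul]
  obtain ⟨a, c, hc⟩ := hp
  obtain ⟨b, e, he⟩ := hq
  refine ⟨max a b, fun k => (if k < M.m ^ a then c k else 0) - if k < M.m ^ b then e k else 0,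
    fun ω => ?_⟩
  rw [hc, he, key c a _ (le_max_left a b), key e b _ (le_max_right a b),
    ← Finset.sum_sub_distrib]
  simp only [sub_mul]

theorem IsMask.unique {φ : V D → ℂ} (horth : IsOrthogonal φ)
    (hφ : MemLp φ 2 (haar D)) (hint : Integrable φ (haar D)) {p q : V E → ℂ}
    (hp : IsMask φ p) (hq : IsMask φ q) : p = q := by
  obtain ⟨n, c, hc⟩ := hp.1.exists_common hq.1
  have h0 : (fun x => ∑ k ∈ Finset.range (M.m ^ n), c k * φ (x + gam D k)) =ᵐ[haar D] 0 := by
    refine ae_eq_zero_of_fourier_eq_zero (E := E)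
      (integrable_finsetSum _ fun k _ => (hint.comp_add_right (gam D k)).const_mul _) fun ω => ?_
    have h1 : fourier E (fun x => ∑ k ∈ Finset.range (M.m ^ n), c k * φ (x + gam D k)) ω =
        ∑ k ∈ Finset.range (M.m ^ n), c k * fourier E (fun x => φ (x + gam D k)) ω := by
      simp only [fourier, ← integral_const_mul, Finset.sum_mul, mul_assoc]
      exact integral_finsetSum _ fun k _ =>
        (integrable_mul_conj_chi (hint.comp_add_right (gam D k)) ω).const_mul _
    -- At 𝓜*ω the two mask equations have the same left side, so (p - q)φ̂ = 0 at ω. This product is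
    -- the Fourier transform of ∑ c_k φ(· ⊕ γ_[k]).
    have h2 := (hp.2 (dil ω)).symm.trans (hq.2 (dil ω))
    rw [Equiv.symm_apply_apply, ← sub_eq_zero, ← sub_mul, hc] at h2
    rw [h1, ← h2, Finset.sum_mul]
    refine Finset.sum_congr rfl fun k _ => ?_
    rw [fourier_translate, walsh, mul_assoc]
  ext ω
  rw [← sub_eq_zero, hc]
  refine Finset.sum_eq_zero fun k hk => ?_
  rw [horth.coeff_eq_zero hφ h0 (Finset.mem_range.mp hk), zero_mul]

end

end Vilenkin

theorem theorem5 {d : ℕ} (hd : 0 < d) (M : Vilenkin.DilationMatrix d)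
    (D : Vilenkin.DigitSet M) (Dstar : Vilenkin.DigitSet M.transpose)
    (φ : Vilenkin.V D → ℂ) (hrefinable : Vilenkin.IsRefinable φ)
    (hsupport : HasCompactSupport φ) (horthogonal : Vilenkin.IsOrthogonal φ) :
    (∃! m₀ : Vilenkin.V Dstar → ℂ, Vilenkin.IsMask φ m₀) ∧
    ∀ m₀ : Vilenkin.V Dstar → ℂ, Vilenkin.IsMask φ m₀ →
      ∀ ω : Vilenkin.V Dstar,
        ∑ k : Fin M.transpose.m,
          ‖m₀ (Vilenkin.V.dil.symm (ω + Vilenkin.V.ofDigit Dstar k))‖ ^ 2 = 1 := by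
  obtain ⟨n, α, hα⟩ := hrefinable.exists_finite_sum (M.one_lt_m hd) hsupport
  have hint := Vilenkin.integrable_of_memLp_two hrefinable.1 hsupport
  have hmask : Vilenkin.IsMask φ (Vilenkin.coeffMask D Dstar n α) :=
    Vilenkin.isMask_coeffMask hint hα
  refine ⟨⟨_, hmask, fun p hp => hp.unique horthogonal hrefinable.1 hint hmask⟩,
    fun p hp ω => ?_⟩
  rw [hp.unique horthogonal hrefinable.1 hint hmask]
  exact Vilenkin.sum_norm_sq_coeffMask horthogonal hrefinable.1 hα ω
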